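/- Let $\alpha\in(0,1)$ be irrational, with regular continued fraction expansion $\alpha=[0;a_1,a_2,a_3,\dots]$. Let $p_1=0$, $p_2=1$, $q_1=1$, $q_2=a_1$ and, for $n\ge 2$, $p_{n+1}=a_np_n+p_{n-1}$ and $q_{n+1}=a_nq_n+q_{n-1}$ (so $p_n/q_n$ are the convergents of $\alpha$), and put $\alpha_n=|q_n\alpha-p_n|$ for $n\ge1$. (This is the distance $\|q_n\alpha\|$ from $q_n\alpha$ to the nearest integer, except when $n=1$ and $\alpha>1/2$.) Let $\mathcal V_\alpha$ be the set of all $x\in(0,1)$ for which there is exactly one sequence of integers $(x_n)_{n\ge1}$ with $0\le x_n\le a_n$ for all $n\ge 1$ and $$x=\sum_{n=1}^\infty x_n\alpha_n.$$ Then $\mathcal V_\alpha$ has Lebesgue measure zero if and only if $\sum_{n=1}^\infty \frac1{a_n}=+\infty$. -/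

import Mathlib

open Filter MeasureTheory

/-- The partial quotients of the regular continued fraction of `α`, indexed from `0`: for irrational
`α ∈ (0,1)` with `α = 1/(a₁ + 1/(a₂ + ⋯))`, `partialQuotient α n` is `a_{n+1}`
(see `partDens_get?_eq`). -/
noncomputable def partialQuotient (α : ℝ) (n : ℕ) : ℕ :=
  ⌊((GenContFract.of α).partDens.get? n).getD 0⌋₊

/-- `partialQuotient` is the sequence of partial denominators of Mathlib's continued fraction. -/
theorem partDens_get?_eq {α : ℝ} (hα : Irrational α) (n : ℕ) :
    (GenContFract.of α).partDens.get? n = some (partialQuotient α n : ℝ) := by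
  have hterm : ¬ (GenContFract.of α).Terminates := by
    rw [GenContFract.terminates_iff_rat]
    rintro ⟨q, hq⟩
    exact hα ⟨q, hq.symm⟩
  cases h : (GenContFract.of α).partDens.get? n with
  | none =>
    exact absurd ⟨n, GenContFract.terminatedAt_iff_partDen_none.2 h⟩ hterm
  | some b =>
    obtain ⟨z, rfl⟩ : ∃ z : ℤ, b = (z : ℝ) := by
      obtain ⟨gp, hgp, rfl⟩ := GenContFract.exists_s_b_of_partDen h
      exact (GenContFract.of_partNum_eq_one_and_exists_int_partDen_eq hgp).2
    have h1 : (1 : ℝ) ≤ z := GenContFract.of_one_le_get?_partDen h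
    have h2 : (0 : ℤ) ≤ z := by
      have : (1 : ℤ) ≤ z := by exact_mod_cast h1
      omega
    obtain ⟨m, rfl⟩ := Int.eq_ofNat_of_zero_le h2
    simp [partialQuotient, h]

/-- The sequence `|q_n α - p_n|`, indexed from `0`. Mathlib numbers the convergents of `α ∈ (0,1)` as
`nums 0 / dens 0 = 0 / 1`, `nums 1 / dens 1 = 1 / a₁`, …, so that, with the numbering `p₁ = 0`,
`q₁ = 1`, `p₂ = 1`, `q₂ = a₁`, `p_{n+1} = a_n p_n + p_{n-1}`, `q_{n+1} = a_n q_n + q_{n-1}`,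
`rotBase α n` is `α_{n+1} = |q_{n+1} α - p_{n+1}|`. -/
noncomputable def rotBase (α : ℝ) (n : ℕ) : ℝ :=
  |(GenContFract.of α).dens n * α - (GenContFract.of α).nums n|

/-- The space `∏_{n ≥ 1} {0, 1, …, a_n}` of digit sequences (again indexed from `0`). -/
def digitSpace (α : ℝ) : Set (ℕ → ℕ) :=
  {x | ∀ n, x n ≤ partialQuotient α n}

/-- The set of `t ∈ (0,1)` with exactly one expansion `t = ∑ x_n α_n`, `(x_n)` in `digitSpace α`. -/
def uniqueExpansionSet (α : ℝ) : Set ℝ :=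
  {t | t ∈ Set.Ioo (0 : ℝ) 1 ∧
    ∃! x : ℕ → ℕ, x ∈ digitSpace α ∧ HasSum (fun n => (x n : ℝ) * rotBase α n) t}

/-! Only the recurrence `c n = a n * c (n + 1) + c (n + 2)` matters. It makes the tail expansions
from `k` on represent exactly `[0, c k + c (k + 1)]`. Prescribing the first digit gives translates
of `[0, c (k + 1) + c (k + 2)]` by multiples of `c (k + 1)`; neighbouring translates overlap in
length `c (k + 2)`, and uniqueness means avoiding all overlaps.

A point below `c (k + 1)` has first digit `0`, so up to the countable scale it suffices to study the
points of `(c (k + 1), c k)`. There uniqueness forces a first digit in `1, …, a k - 1` and a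
remainder in `(c (k + 2), c (k + 1))` (`uniqueCore_subset`); conversely, such remainders at every
step force all digits (`iInter_forcedCore_subset`). This is a Cantor construction: an interval is
replaced by `a k - 1` translates of the next one.

The retained proportion lies between `1 - 2 / a (k + 1)` (if `a k ≥ 2`) and `1 - 1 / (2 * a (k +
1))`. The product of the upper bounds vanishes if `∑ 1 / a n` diverges; if it converges, far enough
out the product of the lower bounds stays positive. -/

/-! ### The rotation scale of an irrational number -/

/-- The sequence `1, α₁, α₂, …`: the sequence `rotBase α`, preceded by `1`. -/
noncomputable def rotScale (α : ℝ) : ℕ → ℝ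
  | 0 => 1
  | n + 1 => rotBase α n

theorem not_terminatedAt_of_irrational {α : ℝ} (hα : Irrational α) (n : ℕ) :
    ¬ (GenContFract.of α).TerminatedAt n := by
  rw [GenContFract.terminatedAt_iff_partDen_none, partDens_get?_eq hα n]
  simp

theorem get?_of_irrational {α : ℝ} (hα : Irrational α) (n : ℕ) :
    (GenContFract.of α).s.get? n = some ⟨1, (partialQuotient α n : ℝ)⟩ := by
  obtain ⟨gp, hgp, hb⟩ := GenContFract.exists_s_b_of_partDen (partDens_get?_eq hα n)
  have ha := (GenContFract.of_partNum_eq_one_and_exists_int_partDen_eq hgp).1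
  rw [hgp]
  cases gp
  simp_all

theorem one_le_partialQuotient {α : ℝ} (hα : Irrational α) (n : ℕ) : 1 ≤ partialQuotient α n := by
  exact_mod_cast GenContFract.of_one_le_get?_partDen (partDens_get?_eq hα n)

theorem dens_pos_of_irrational {α : ℝ} (hα : Irrational α) (n : ℕ) :
    0 < (GenContFract.of α).dens n := by
  have h := GenContFract.succ_nth_fib_le_of_nth_den (v := α) (n := n)
    (Or.inr (not_terminatedAt_of_irrational hα _))
  exact lt_of_lt_of_le (by exact_mod_cast Nat.fib_pos.2 n.succ_pos) h

/-- `sub_convs_eq` gives the error of a convergent as `(-1) ^ n` over a positive number, unless the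
fractional part vanishes, which irrationality excludes. -/
theorem neg_one_pow_mul_dens_mul_sub_nums_pos {α : ℝ} (hα : Irrational α) (n : ℕ) :
    0 < (-1) ^ n * ((GenContFract.of α).dens n * α - (GenContFract.of α).nums n) := by
  have hB := dens_pos_of_irrational hα n
  obtain ⟨ifp, hifp⟩ : ∃ ifp, GenContFract.IntFractPair.stream α n = some ifp := by
    cases n with
    | zero => exact ⟨_, GenContFract.IntFractPair.stream_zero α⟩
    | succ m =>
      rw [← Option.ne_none_iff_exists']
      intro h
      exact not_terminatedAt_of_irrational hα m
        (GenContFract.of_terminatedAt_n_iff_succ_nth_intFractPair_stream_eq_none.2 h)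
  have hsub := GenContFract.sub_convs_eq hifp
  have hfr := GenContFract.IntFractPair.nth_stream_fr_nonneg hifp
  obtain ⟨q, hq⟩ := GenContFract.exists_rat_eq_nth_conv α n
  have hne : α - (GenContFract.of α).convs n ≠ 0 := by
    intro h
    exact hα ⟨q, by rw [← hq]; linarith⟩
  have hBeq : ((GenContFract.of α).contsAux (n + 1)).b = (GenContFract.of α).dens n := rfl
  have hpB : 0 ≤ ((GenContFract.of α).contsAux n).b := GenContFract.zero_le_of_contsAux_b
  simp only [hBeq] at hsub
  split_ifs at hsub with h0
  · exact absurd hsub hne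
  have hfr' : 0 < ifp.fr := lt_of_le_of_ne hfr (Ne.symm h0)
  have hfactor : (GenContFract.of α).dens n * α - (GenContFract.of α).nums n =
      (GenContFract.of α).dens n * (α - (GenContFract.of α).convs n) := by
    rw [GenContFract.conv_eq_num_div_den]
    field_simp
  have hsq : ((-1 : ℝ) ^ n) * (-1) ^ n = 1 := by
    rw [← mul_pow]; simp
  rw [hfactor, hsub]
  calc (0 : ℝ) < (GenContFract.of α).dens n * (1 / ((GenContFract.of α).dens n *
        (ifp.fr⁻¹ * (GenContFract.of α).dens n + ((GenContFract.of α).contsAux n).b))) := by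
        positivity
    _ = _ := by
        rw [← mul_div_assoc, ← mul_div_assoc, ← mul_div_assoc, mul_one,
          mul_left_comm, hsq, mul_one]

theorem rotBase_eq {α : ℝ} (hα : Irrational α) (n : ℕ) :
    rotBase α n = (-1) ^ n * ((GenContFract.of α).dens n * α - (GenContFract.of α).nums n) := by
  have h := neg_one_pow_mul_dens_mul_sub_nums_pos hα n
  rw [rotBase, ← abs_of_pos h, abs_mul, abs_pow]
  simp

/-- `c` is a scale for the digit bounds `a` if it is positive and satisfies the Euclidean recurrence
`c n = a n * c (n + 1) + c (n + 2)`. -/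
structure IsEuclideanScale (a : ℕ → ℕ) (c : ℕ → ℝ) : Prop where
  one_le : ∀ n, 1 ≤ a n
  pos : ∀ n, 0 < c n
  recurrence : ∀ n, c n = a n * c (n + 1) + c (n + 2)

/-- The errors `q_n α - p_n` alternate in sign, so the recurrence of the convergents becomes the
Euclidean one for their absolute values. -/
theorem isEuclideanScale_rotScale {α : ℝ} (hirr : Irrational α) (hα : α ∈ Set.Ioo (0 : ℝ) 1) :
    IsEuclideanScale (partialQuotient α) (rotScale α) where
  one_le := one_le_partialQuotient hirr
  pos n := by
    cases n with
    | zero => exact one_pos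
    | succ n =>
      rw [rotScale, rotBase_eq hirr]
      exact neg_one_pow_mul_dens_mul_sub_nums_pos hirr n
  recurrence n := by
    have hh : (GenContFract.of α).h = 0 := by
      rw [GenContFract.of_h_eq_floor, Int.floor_eq_zero_iff.2 ⟨hα.1.le, hα.2⟩, Int.cast_zero]
    cases n with
    | zero =>
      have h0 := get?_of_irrational hirr 0
      simp only [rotScale, rotBase_eq hirr, GenContFract.first_num_eq h0,
        GenContFract.first_den_eq h0, GenContFract.zeroth_num_eq_h,
        GenContFract.zeroth_den_eq_one, hh]
      ring
    | succ n =>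
      have hn := get?_of_irrational hirr (n + 1)
      simp only [rotScale, rotBase_eq hirr, GenContFract.nums_recurrence hn rfl rfl,
        GenContFract.dens_recurrence hn rfl rfl]
      ring

/-! ### Expansions in a Euclidean scale -/

/-- `x` is a digit sequence of `t` in the tail of the scale `c` that starts at the index `k + 1`. -/
def IsTailExpansion (a : ℕ → ℕ) (c : ℕ → ℝ) (k : ℕ) (t : ℝ) (x : ℕ → ℕ) : Prop :=
  (∀ n, x n ≤ a (k + n)) ∧ HasSum (fun n => (x n : ℝ) * c (k + n + 1)) t

/-- The sequence `d, y 0, y 1, …`. -/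
def consDigit (d : ℕ) (y : ℕ → ℕ) : ℕ → ℕ
  | 0 => d
  | n + 1 => y n

theorem consDigit_eta (x : ℕ → ℕ) : consDigit (x 0) (fun n => x (n + 1)) = x := by
  funext n
  cases n <;> rfl

theorem isTailExpansion_consDigit {a : ℕ → ℕ} {c : ℕ → ℝ} {k d : ℕ} {t : ℝ} {y : ℕ → ℕ} :
    IsTailExpansion a c k t (consDigit d y) ↔
      d ≤ a k ∧ IsTailExpansion a c (k + 1) (t - d * c (k + 1)) y := by
  have hsum : HasSum (fun n => (consDigit d y n : ℝ) * c (k + n + 1)) t ↔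
      HasSum (fun n => (y n : ℝ) * c (k + 1 + n + 1)) (t - d * c (k + 1)) := by
    rw [← hasSum_nat_add_iff' 1]
    simp only [Finset.sum_range_one, consDigit, add_zero]
    have hidx : ∀ n, k + (n + 1) + 1 = k + 1 + n + 1 := fun n => by omega
    simp only [hidx]
  constructor
  · rintro ⟨hle, hs⟩
    refine ⟨hle 0, fun n => ?_, hsum.1 hs⟩
    have := hle (n + 1)
    rwa [show k + (n + 1) = k + 1 + n by omega] at this
  · rintro ⟨hd, hle, hs⟩
    refine ⟨fun n => ?_, hsum.2 hs⟩
    cases n with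
    | zero => exact hd
    | succ n =>
      rw [show k + (n + 1) = k + 1 + n by omega]
      exact hle n

theorem IsTailExpansion.tail {a : ℕ → ℕ} {c : ℕ → ℝ} {k : ℕ} {t : ℝ} {x : ℕ → ℕ}
    (h : IsTailExpansion a c k t x) :
    x 0 ≤ a k ∧ IsTailExpansion a c (k + 1) (t - x 0 * c (k + 1)) (fun n => x (n + 1)) := by
  rw [← isTailExpansion_consDigit, consDigit_eta]
  exact h

namespace IsEuclideanScale

variable {a : ℕ → ℕ} {c : ℕ → ℝ}

theorem succ_lt (h : IsEuclideanScale a c) (n : ℕ) : c (n + 1) < c n := by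
  have h1 : (1 : ℝ) ≤ a n := by exact_mod_cast h.one_le n
  have := h.recurrence n
  nlinarith [h.pos (n + 1), h.pos (n + 2)]

theorem strictAnti (h : IsEuclideanScale a c) : StrictAnti c :=
  strictAnti_nat_of_succ_lt h.succ_lt

theorem tendsto_zero (h : IsEuclideanScale a c) : Tendsto c atTop (nhds 0) := by
  have hbdd : BddBelow (Set.range c) := ⟨0, by rintro _ ⟨n, rfl⟩; exact (h.pos n).le⟩
  have hlim := tendsto_atTop_ciInf h.strictAnti.antitone hbdd
  set L := ⨅ n, c n
  have hL0 : 0 ≤ L := ge_of_tendsto' hlim fun n => (h.pos n).le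
  have h1 := hlim.comp (tendsto_add_atTop_nat 1)
  have h2 := hlim.comp (tendsto_add_atTop_nat 2)
  -- Since `a n ≥ 1`, the recurrence gives `c (n + 1) + c (n + 2) ≤ c n`; pass to the limit.
  have hle : L + L ≤ L := by
    refine le_of_tendsto_of_tendsto' (h1.add h2) hlim fun n => ?_
    have ha : (1 : ℝ) ≤ a n := by exact_mod_cast h.one_le n
    have := h.recurrence n
    simp only [Function.comp_apply]
    nlinarith [h.pos (n + 1)]
  have hL : L = 0 := by linarith
  rwa [hL] at hlim

/-- The series telescopes: each term is `(c m + c (m + 1)) - (c (m + 1) + c (m + 2))` with `m = k +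
n`. -/
theorem hasSum_digit_bounds (h : IsEuclideanScale a c) (k : ℕ) :
    HasSum (fun n => (a (k + n) : ℝ) * c (k + n + 1)) (c k + c (k + 1)) := by
  rw [hasSum_iff_tendsto_nat_of_nonneg
    fun n => mul_nonneg (Nat.cast_nonneg _) (h.pos _).le]
  have hpartial : ∀ N, ∑ n ∈ Finset.range N, (a (k + n) : ℝ) * c (k + n + 1) =
      c k + c (k + 1) - (c (N + k) + c (N + (k + 1))) := by
    intro N
    induction N with
    | zero => simp
    | succ N ih =>
      rw [Finset.sum_range_succ, ih]
      have := h.recurrence (k + N)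
      rw [show N + k = k + N by omega, show N + (k + 1) = k + N + 1 by omega,
        show N + 1 + k = k + N + 1 by omega, show N + 1 + (k + 1) = k + N + 2 by omega]
      linarith
  simp only [hpartial]
  have h1 := h.tendsto_zero.comp (tendsto_add_atTop_nat k)
  have h2 := h.tendsto_zero.comp (tendsto_add_atTop_nat (k + 1))
  simpa using (h1.add h2).const_sub (c k + c (k + 1))

theorem mem_Icc_of_isTailExpansion (h : IsEuclideanScale a c) {k : ℕ} {t : ℝ} {x : ℕ → ℕ}
    (hx : IsTailExpansion a c k t x) : t ∈ Set.Icc 0 (c k + c (k + 1)) := by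
  refine ⟨hx.2.nonneg fun n => mul_nonneg (Nat.cast_nonneg _) (h.pos _).le,
    hasSum_le (fun n => ?_) hx.2 (h.hasSum_digit_bounds k)⟩
  exact mul_le_mul_of_nonneg_right (by exact_mod_cast hx.1 n) (h.pos _).le

theorem exists_digit (h : IsEuclideanScale a c) {k : ℕ} {t : ℝ}
    (ht : t ∈ Set.Icc 0 (c k + c (k + 1))) :
    ∃ d ≤ a k, t - d * c (k + 1) ∈ Set.Icc 0 (c (k + 1) + c (k + 2)) := by
  have hc := h.pos (k + 1)
  have hc2 := h.pos (k + 2)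
  have hrec := h.recurrence k
  -- Greedy choice: the integer part of `t / c (k + 1)`, capped at `a k`.
  by_cases hbig : a k * c (k + 1) ≤ t
  · exact ⟨a k, le_rfl, by linarith, by linarith [ht.2]⟩
  · have h0 : 0 ≤ t / c (k + 1) := div_nonneg ht.1 hc.le
    refine ⟨⌊t / c (k + 1)⌋₊, ?_, ?_, ?_⟩
    · refine Nat.floor_le_of_le ?_
      rw [div_le_iff₀ hc]
      exact (not_le.1 hbig).le
    · have := (le_div_iff₀ hc).1 (Nat.floor_le h0)
      linarith
    · have := (div_lt_iff₀ hc).1 (Nat.lt_floor_add_one (t / c (k + 1)))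
      linarith

theorem exists_isTailExpansion (h : IsEuclideanScale a c) {k : ℕ} {t : ℝ}
    (ht : t ∈ Set.Icc 0 (c k + c (k + 1))) : ∃ x, IsTailExpansion a c k t x := by
  choose! d hda hd using fun (k : ℕ) (t : ℝ) (ht : t ∈ Set.Icc 0 (c k + c (k + 1))) =>
    h.exists_digit ht
  -- `r n` is the remainder after `n` greedy digits; it is squeezed to `0` by the interval bounds.
  let r : ℕ → ℝ := fun n => Nat.rec t (fun n s => s - d (k + n) s * c (k + n + 1)) n
  have hr : ∀ n, r n ∈ Set.Icc 0 (c (k + n) + c (k + n + 1)) := by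
    intro n
    induction n with
    | zero => exact ht
    | succ n ih => exact hd (k + n) (r n) ih
  refine ⟨fun n => d (k + n) (r n), fun n => hda _ _ (hr n), ?_⟩
  rw [hasSum_iff_tendsto_nat_of_nonneg
    fun n => mul_nonneg (Nat.cast_nonneg _) (h.pos _).le]
  have hpartial : ∀ N, ∑ n ∈ Finset.range N, (d (k + n) (r n) : ℝ) * c (k + n + 1) =
      t - r N := by
    intro N
    induction N with
    | zero => simp [r]
    | succ N ih =>
      have hstep : r (N + 1) = r N - d (k + N) (r N) * c (k + N + 1) := rfl
      rw [Finset.sum_range_succ, ih, hstep]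
      ring
  simp only [hpartial]
  have h1 := h.tendsto_zero.comp (tendsto_add_atTop_nat k)
  have h2 := h.tendsto_zero.comp (tendsto_add_atTop_nat (k + 1))
  have hr0 : Tendsto r atTop (nhds 0) := by
    refine tendsto_of_tendsto_of_tendsto_of_le_of_le tendsto_const_nhds
      (by simpa using h1.add h2) (fun n => (hr n).1) fun n => ?_
    have := (hr n).2
    rwa [show k + n = n + k by omega] at this
  simpa using hr0.const_sub t

end IsEuclideanScale

/-! ### Unique expansions -/

/-- The points of `(c (k + 1), c k)` with exactly one expansion in the tail of the scale. -/
def uniqueCore (a : ℕ → ℕ) (c : ℕ → ℝ) (k : ℕ) : Set ℝ :=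
  {t | t ∈ Set.Ioo (c (k + 1)) (c k) ∧ ∃! x, IsTailExpansion a c k t x}

/-- The points of `(c (k + 1), c k)` whose digits are forced at the `n` places from `k` on. -/
def forcedCore (a : ℕ → ℕ) (c : ℕ → ℝ) : ℕ → ℕ → Set ℝ
  | 0, k => Set.Ioo (c (k + 1)) (c k)
  | n + 1, k => ⋃ d ∈ Finset.Icc 1 (a k - 1),
      (fun t : ℝ => t - d * c (k + 1)) ⁻¹' forcedCore a c n (k + 1)

theorem existsUnique_isTailExpansion_tail {a : ℕ → ℕ} {c : ℕ → ℝ} {k : ℕ} {t : ℝ} {x : ℕ → ℕ}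
    (hx : IsTailExpansion a c k t x) (huniq : ∀ y, IsTailExpansion a c k t y → y = x) :
    ∃! y, IsTailExpansion a c (k + 1) (t - x 0 * c (k + 1)) y := by
  refine ⟨_, hx.tail.2, fun y hy => ?_⟩
  have := huniq (consDigit (x 0) y) (isTailExpansion_consDigit.2 ⟨hx.tail.1, hy⟩)
  funext n
  exact congrFun this (n + 1)

namespace IsEuclideanScale

variable {a : ℕ → ℕ} {c : ℕ → ℝ}

theorem isTailExpansion_iff_of_lt (h : IsEuclideanScale a c) {k : ℕ} {t : ℝ} (ht : t < c (k + 1))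
    {x : ℕ → ℕ} : IsTailExpansion a c k t x ↔
      ∃ y, IsTailExpansion a c (k + 1) t y ∧ x = consDigit 0 y := by
  constructor
  · intro hx
    obtain ⟨hd, htail⟩ := hx.tail
    have hx0 : x 0 = 0 := by
      by_contra hne
      have h1 : (1 : ℝ) ≤ x 0 := by exact_mod_cast Nat.one_le_iff_ne_zero.2 hne
      have := (h.mem_Icc_of_isTailExpansion htail).1
      nlinarith [h.pos (k + 1)]
    refine ⟨_, by simpa [hx0] using htail, ?_⟩
    rw [← hx0, consDigit_eta]
  · rintro ⟨y, hy, rfl⟩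
    exact isTailExpansion_consDigit.2 ⟨Nat.zero_le _, by simpa using hy⟩

theorem existsUnique_isTailExpansion_succ_iff (h : IsEuclideanScale a c) {k : ℕ} {t : ℝ}
    (ht : t < c (k + 1)) :
    (∃! x, IsTailExpansion a c (k + 1) t x) ↔ ∃! x, IsTailExpansion a c k t x := by
  constructor
  · rintro ⟨y, hy, huniq⟩
    refine ⟨consDigit 0 y, (h.isTailExpansion_iff_of_lt ht).2 ⟨y, hy, rfl⟩, fun z hz => ?_⟩
    obtain ⟨w, hw, rfl⟩ := (h.isTailExpansion_iff_of_lt ht).1 hz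
    rw [huniq w hw]
  · rintro ⟨x, hx, huniq⟩
    obtain ⟨y, hy, rfl⟩ := (h.isTailExpansion_iff_of_lt ht).1 hx
    refine ⟨y, hy, fun z hz => ?_⟩
    have := huniq _ ((h.isTailExpansion_iff_of_lt ht).2 ⟨z, hz, rfl⟩)
    funext n
    exact congrFun this (n + 1)

theorem existsUnique_isTailExpansion_iff_of_lt (h : IsEuclideanScale a c) {k : ℕ} {t : ℝ}
    (ht : t < c k) :
    (∃! x, IsTailExpansion a c k t x) ↔ ∃! x, IsTailExpansion a c 0 t x := by
  induction k with
  | zero => rfl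
  | succ k ih =>
    rw [h.existsUnique_isTailExpansion_succ_iff ht, ih (ht.trans (h.succ_lt k))]

/-- A point with a unique expansion that lies strictly between two consecutive elements of the
scale stays so after its first digit is removed. -/
theorem uniqueCore_subset (h : IsEuclideanScale a c) (k : ℕ) :
    uniqueCore a c k ⊆ ⋃ d ∈ Finset.Icc 1 (a k - 1),
      (fun t : ℝ => t - d * c (k + 1)) ⁻¹' uniqueCore a c (k + 1) := by
  rintro t ⟨⟨hlo, hhi⟩, x, hx, huniq⟩
  have hc := h.pos (k + 1)
  have hc2 := h.succ_lt (k + 1)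
  have hrec := h.recurrence k
  obtain ⟨hd, htail⟩ := hx.tail
  have hmem := h.mem_Icc_of_isTailExpansion htail
  -- Any first digit with an admissible remainder extends to an expansion, so uniqueness leaves only
  -- `x 0`.
  have hdigit : ∀ d ≤ a k, t - d * c (k + 1) ∈ Set.Icc 0 (c (k + 1) + c (k + 2)) → d = x 0 := by
    intro d hda hdm
    obtain ⟨y, hy⟩ := h.exists_isTailExpansion hdm
    exact congrFun (huniq _ (isTailExpansion_consDigit.2 ⟨hda, hy⟩)) 0
  -- Otherwise `x 0 + 1` is also admissible, or, at the cap `x 0 = a k`, `t` exceeds `c k`.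
  have hupper : t - x 0 * c (k + 1) < c (k + 1) := by
    by_contra! hge
    rcases hd.lt_or_eq with hlt | heq
    · have := hdigit (x 0 + 1) hlt (by
        push_cast
        constructor <;> linarith [hmem.2])
      omega
    · rw [heq] at hge
      linarith
  -- Otherwise `x 0 - 1` is also admissible, or `x 0 = 0` and `t` is too small.
  have hlower : c (k + 2) < t - x 0 * c (k + 1) := by
    by_contra! hle
    rcases Nat.eq_zero_or_pos (x 0) with h0 | hpos
    · rw [h0, Nat.cast_zero] at hle
      linarith
    · have := hdigit (x 0 - 1) (by omega) (by
        rw [Nat.cast_sub hpos, Nat.cast_one]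
        constructor <;> linarith [hmem.1])
      omega
  have h1 : 1 ≤ x 0 := by
    by_contra! h0
    rw [Nat.lt_one_iff.1 h0, Nat.cast_zero] at hupper
    linarith
  have h2 : x 0 ≠ a k := by
    intro heq
    rw [heq] at hlower
    linarith
  simp only [Set.mem_iUnion, Finset.mem_Icc]
  exact ⟨x 0, ⟨h1, by omega⟩, ⟨hlower, hupper⟩, existsUnique_isTailExpansion_tail hx huniq⟩

theorem forcedCore_subset_Ioo (h : IsEuclideanScale a c) (n k : ℕ) :
    forcedCore a c n k ⊆ Set.Ioo (c (k + 1)) (c k) := by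
  induction n generalizing k with
  | zero => exact subset_rfl
  | succ n ih =>
    intro t ht
    simp only [forcedCore, Set.mem_iUnion, Finset.mem_Icc, Set.mem_preimage] at ht
    obtain ⟨d, ⟨h1, h2⟩, ht⟩ := ht
    have hmem := ih (k + 1) ht
    have hc := h.pos (k + 1)
    have hc2 := h.pos (k + 2)
    have hrec := h.recurrence k
    have h1' : (1 : ℝ) ≤ d := by exact_mod_cast h1
    have h2' : (d : ℝ) + 1 ≤ a k := by
      have : d + 1 ≤ a k := by omega
      exact_mod_cast this
    constructor
    · nlinarith [hmem.1]
    · nlinarith [hmem.2]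

theorem forcedCore_succ_subset (h : IsEuclideanScale a c) (n k : ℕ) :
    forcedCore a c (n + 1) k ⊆ forcedCore a c n k := by
  induction n generalizing k with
  | zero => exact h.forcedCore_subset_Ioo 1 k
  | succ n ih =>
    exact Set.iUnion₂_mono fun d _ => Set.preimage_mono (ih (k + 1))

/-- A larger digit makes the remainder negative; a smaller one pushes it above `c (k + 1) + c (k +
2)`. -/
theorem digit_eq_of_sub_mem_Ioo (h : IsEuclideanScale a c) {k d : ℕ} {t : ℝ} {x : ℕ → ℕ}
    (ht : t - d * c (k + 1) ∈ Set.Ioo (c (k + 2)) (c (k + 1)))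
    (hx : IsTailExpansion a c k t x) : x 0 = d := by
  have hmem := h.mem_Icc_of_isTailExpansion hx.tail.2
  have hc := h.pos (k + 1)
  refine le_antisymm ?_ ?_ <;> by_contra! hlt
  · have : (d : ℝ) + 1 ≤ x 0 := by exact_mod_cast hlt
    nlinarith [hmem.1, ht.2]
  · have : (x 0 : ℝ) + 1 ≤ d := by exact_mod_cast hlt
    nlinarith [hmem.2, ht.1]

theorem digit_eq_of_mem_forcedCore (h : IsEuclideanScale a c) {n k : ℕ} {t : ℝ} {x y : ℕ → ℕ}
    (ht : t ∈ forcedCore a c (n + 1) k) (hx : IsTailExpansion a c k t x)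
    (hy : IsTailExpansion a c k t y) : x n = y n := by
  induction n generalizing k t x y with
  | zero =>
    simp only [forcedCore, Set.mem_iUnion, Set.mem_preimage] at ht
    obtain ⟨d, -, ht⟩ := ht
    rw [h.digit_eq_of_sub_mem_Ioo ht hx, h.digit_eq_of_sub_mem_Ioo ht hy]
  | succ n ih =>
    rw [forcedCore] at ht
    simp only [Set.mem_iUnion, Set.mem_preimage] at ht
    obtain ⟨d, -, ht⟩ := ht
    have hmem := h.forcedCore_subset_Ioo _ _ ht
    have hx' := hx.tail.2
    have hy' := hy.tail.2
    rw [h.digit_eq_of_sub_mem_Ioo hmem hx] at hx'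
    rw [h.digit_eq_of_sub_mem_Ioo hmem hy] at hy'
    exact ih ht hx' hy'

theorem iInter_forcedCore_subset (h : IsEuclideanScale a c) (k : ℕ) :
    ⋂ n, forcedCore a c n k ⊆ uniqueCore a c k := by
  intro t ht
  rw [Set.mem_iInter] at ht
  have hmem : t ∈ Set.Ioo (c (k + 1)) (c k) := ht 0
  obtain ⟨x, hx⟩ := h.exists_isTailExpansion (k := k) (t := t)
    ⟨(h.pos _).le.trans hmem.1.le, by linarith [hmem.2, h.pos (k + 1)]⟩
  exact ⟨hmem, x, hx, fun y hy => funext fun n => h.digit_eq_of_mem_forcedCore (ht (n + 1)) hy hx⟩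

end IsEuclideanScale

/-! ### Measure estimates -/

theorem volume_preimage_sub_const (s : Set ℝ) (x : ℝ) :
    volume ((fun t : ℝ => t - x) ⁻¹' s) = volume s := by
  simpa only [sub_eq_add_neg] using measure_preimage_add_right volume (-x) s

namespace IsEuclideanScale

variable {a : ℕ → ℕ} {c : ℕ → ℝ}

/-- The length lost is exactly `a k * c (k + 2)`, while `c k - c (k + 1) ≤ a k * c (k + 1)` and `c
(k + 1) ≤ 2 * a (k + 1) * c (k + 2)`. -/
theorem length_succ_upper (h : IsEuclideanScale a c) (k : ℕ) :
    ((a k - 1 : ℕ) : ℝ) * (c (k + 1) - c (k + 2)) ≤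
      (c k - c (k + 1)) * (1 - 1 / (2 * a (k + 1))) := by
  have h1 : (1 : ℝ) ≤ a (k + 1) := by exact_mod_cast h.one_le (k + 1)
  have h0 : (1 : ℝ) ≤ a k := by exact_mod_cast h.one_le k
  have hr := h.recurrence k
  have hr1 := h.recurrence (k + 1)
  have hl := h.succ_lt (k + 1)
  have hl2 := h.succ_lt (k + 2)
  have hp := h.pos (k + 2)
  rw [Nat.cast_sub (h.one_le k), Nat.cast_one]
  have hb : c (k + 1) ≤ 2 * a (k + 1) * c (k + 2) := by
    simp only [add_assoc, Nat.reduceAdd] at *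
    nlinarith
  have hloss : (c k - c (k + 1)) * (1 / (2 * a (k + 1))) ≤ a k * c (k + 2) := by
    rw [mul_one_div, div_le_iff₀ (by positivity)]
    nlinarith
  linarith

/-- The loss is again `a k * c (k + 2)`. Here `a k ≥ 2` gives `c k - c (k + 1) ≥ (a k / 2) * c (k +
1)`, whence the factor `2`. -/
theorem length_succ_lower (h : IsEuclideanScale a c) {k : ℕ} (hk : 2 ≤ a k) :
    (c k - c (k + 1)) * (1 - 2 / a (k + 1)) ≤
      ((a k - 1 : ℕ) : ℝ) * (c (k + 1) - c (k + 2)) := by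
  have h1 : (1 : ℝ) ≤ a (k + 1) := by exact_mod_cast h.one_le (k + 1)
  have h0 : (2 : ℝ) ≤ a k := by exact_mod_cast hk
  have hr := h.recurrence k
  have hr1 := h.recurrence (k + 1)
  have hp := h.pos (k + 2)
  have hp1 := h.pos (k + 1)
  have hp3 := h.pos (k + 3)
  rw [Nat.cast_sub (h.one_le k), Nat.cast_one]
  have hb : a (k + 1) * c (k + 2) ≤ c (k + 1) := by
    simp only [add_assoc, Nat.reduceAdd] at *
    linarith
  have hloss : a k * c (k + 2) ≤ (c k - c (k + 1)) * (2 / a (k + 1)) := by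
    rw [← mul_div_assoc, le_div_iff₀ (by positivity)]
    nlinarith
  linarith

theorem volume_uniqueCore_le (h : IsEuclideanScale a c) (n k : ℕ) :
    volume (uniqueCore a c k) ≤ ENNReal.ofReal ((c k - c (k + 1)) *
      Real.exp (-(∑ j ∈ Finset.range n, 1 / (a (k + 1 + j) : ℝ)) / 2)) := by
  induction n generalizing k with
  | zero =>
    refine (measure_mono fun t ht => ht.1).trans ?_
    simp
  | succ n ih =>
    set E := Real.exp (-(∑ j ∈ Finset.range n, 1 / (a (k + 1 + 1 + j) : ℝ)) / 2)
    have hlen : 0 < c k - c (k + 1) := sub_pos.2 (h.succ_lt k)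
    have hexp : 1 - 1 / (2 * a (k + 1)) ≤ Real.exp (-(1 / (a (k + 1) : ℝ)) / 2) := by
      refine le_trans (le_of_eq ?_) (Real.add_one_le_exp _)
      rw [mul_comm 2 (a (k + 1) : ℝ), ← div_div]
      ring
    have hsum : Real.exp (-(∑ j ∈ Finset.range (n + 1), 1 / (a (k + 1 + j) : ℝ)) / 2) =
        Real.exp (-(1 / (a (k + 1) : ℝ)) / 2) * E := by
      rw [← Real.exp_add, Finset.sum_range_succ']
      congr 1
      have hidx : ∀ j, a (k + 1 + (j + 1)) = a (k + 1 + 1 + j) := fun j => by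
        congr 1
        omega
      simp only [hidx, add_zero]
      ring
    calc volume (uniqueCore a c k)
        ≤ ∑ d ∈ Finset.Icc 1 (a k - 1),
            volume ((fun t : ℝ => t - d * c (k + 1)) ⁻¹' uniqueCore a c (k + 1)) :=
          (measure_mono (h.uniqueCore_subset k)).trans (measure_biUnion_finset_le _ _)
      _ = ((a k - 1 : ℕ) : ENNReal) * volume (uniqueCore a c (k + 1)) := by
          simp only [volume_preimage_sub_const, Finset.sum_const, Nat.card_Icc, Nat.add_sub_cancel,
            nsmul_eq_mul]
      _ ≤ ENNReal.ofReal ((a k - 1 : ℕ) : ℝ) *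
            ENNReal.ofReal ((c (k + 1) - c (k + 2)) * E) := by
          rw [ENNReal.ofReal_natCast]
          gcongr
          exact ih (k + 1)
      _ = ENNReal.ofReal (((a k - 1 : ℕ) : ℝ) * (c (k + 1) - c (k + 2)) * E) := by
          rw [← ENNReal.ofReal_mul (Nat.cast_nonneg _), mul_assoc]
      _ ≤ _ := by
          refine ENNReal.ofReal_le_ofReal ?_
          rw [hsum, ← mul_assoc]
          refine mul_le_mul_of_nonneg_right ((h.length_succ_upper k).trans ?_) (Real.exp_pos _).le
          exact mul_le_mul_of_nonneg_left hexp hlen.le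

theorem volume_uniqueCore_eq_zero (h : IsEuclideanScale a c)
    (hdiv : Tendsto (fun N : ℕ => ∑ n ∈ Finset.range N, 1 / (a n : ℝ)) atTop atTop) (k : ℕ) :
    volume (uniqueCore a c k) = 0 := by
  have hnonneg : ∀ n, 0 ≤ 1 / (a n : ℝ) := fun n => by positivity
  have htail : Tendsto (fun N : ℕ => ∑ j ∈ Finset.range N, 1 / (a (k + 1 + j) : ℝ))
      atTop atTop := by
    rw [← not_summable_iff_tendsto_nat_atTop_of_nonneg fun n => hnonneg _]
    rw [← not_summable_iff_tendsto_nat_atTop_of_nonneg hnonneg] at hdiv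
    rw [← summable_nat_add_iff (k + 1)] at hdiv
    simpa only [add_comm] using hdiv
  have hexp : Tendsto (fun N : ℕ => (c k - c (k + 1)) *
      Real.exp (-(∑ j ∈ Finset.range N, 1 / (a (k + 1 + j) : ℝ)) / 2)) atTop (nhds 0) := by
    have hneg := tendsto_neg_atTop_atBot.comp (htail.atTop_div_const (two_pos (α := ℝ)))
    have := (Real.tendsto_exp_atBot.comp hneg).const_mul (c k - c (k + 1))
    simpa [Function.comp_def, neg_div] using this
  have hlim := (ENNReal.continuous_ofReal.tendsto 0).comp hexp
  rw [ENNReal.ofReal_zero] at hlim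
  exact le_antisymm (ge_of_tendsto' hlim fun n => h.volume_uniqueCore_le n k) zero_le

theorem measurableSet_forcedCore (a : ℕ → ℕ) (c : ℕ → ℝ) (n k : ℕ) :
    MeasurableSet (forcedCore a c n k) := by
  induction n generalizing k with
  | zero => exact measurableSet_Ioo
  | succ n ih =>
    exact Finset.measurableSet_biUnion _ fun d _ => measurable_id.sub_const _ (ih (k + 1))

theorem volume_forcedCore_succ (h : IsEuclideanScale a c) (n k : ℕ) :
    volume (forcedCore a c (n + 1) k) =
      ((a k - 1 : ℕ) : ENNReal) * volume (forcedCore a c n (k + 1)) := by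
  rw [forcedCore, measure_biUnion_finset]
  · simp only [volume_preimage_sub_const, Finset.sum_const, Nat.card_Icc, Nat.add_sub_cancel,
      nsmul_eq_mul]
  · intro d _ e _ hde
    -- The translate with digit `d` lies between `d * c (k + 1)` and `(d + 1) * c (k + 1)`.
    refine Set.disjoint_left.2 fun t htd hte => hde ?_
    have hd := h.forcedCore_subset_Ioo _ _ htd
    have he := h.forcedCore_subset_Ioo _ _ hte
    have hc := h.pos (k + 1)
    have hc2 := h.pos (k + 2)
    have hd1 := hd.1
    have hd2 := hd.2
    have he1 := he.1
    have he2 := he.2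
    simp only [add_assoc, Nat.reduceAdd] at hd1 he1
    refine le_antisymm ?_ ?_ <;> by_contra! hlt
    · have : (e : ℝ) + 1 ≤ d := by exact_mod_cast hlt
      nlinarith
    · have : (d : ℝ) + 1 ≤ e := by exact_mod_cast hlt
      nlinarith
  · exact fun d _ => measurable_id.sub_const _ (measurableSet_forcedCore a c n (k + 1))

theorem le_volume_forcedCore (h : IsEuclideanScale a c) (n k : ℕ) (htwo : ∀ j, k ≤ j → 2 ≤ a j)
    (hsum : ∑ j ∈ Finset.range n, 2 / (a (k + 1 + j) : ℝ) ≤ 1) :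
    ENNReal.ofReal ((c k - c (k + 1)) * (1 - ∑ j ∈ Finset.range n, 2 / (a (k + 1 + j) : ℝ))) ≤
      volume (forcedCore a c n k) := by
  induction n generalizing k with
  | zero => simp [forcedCore]
  | succ n ih =>
    have hlen : 0 < c k - c (k + 1) := sub_pos.2 (h.succ_lt k)
    have hsplit : ∑ j ∈ Finset.range (n + 1), 2 / (a (k + 1 + j) : ℝ) =
        ∑ j ∈ Finset.range n, 2 / (a (k + 1 + 1 + j) : ℝ) + 2 / a (k + 1) := by
      rw [Finset.sum_range_succ']
      have hidx : ∀ j, a (k + 1 + (j + 1)) = a (k + 1 + 1 + j) := fun j => by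
        congr 1
        omega
      simp only [hidx, add_zero]
    rw [hsplit] at hsum ⊢
    set S := ∑ j ∈ Finset.range n, 2 / (a (k + 1 + 1 + j) : ℝ)
    have hS : 0 ≤ S := Finset.sum_nonneg fun j _ => by positivity
    have hx : 0 ≤ 2 / (a (k + 1) : ℝ) := by positivity
    rw [h.volume_forcedCore_succ, ← ENNReal.ofReal_natCast]
    refine le_trans ?_ (mul_le_mul_right (ih (k + 1) (fun j hj => htwo j (by omega))
      (by linarith)) _)
    rw [← ENNReal.ofReal_mul (Nat.cast_nonneg _)]
    refine ENNReal.ofReal_le_ofReal ?_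
    calc (c k - c (k + 1)) * (1 - (S + 2 / a (k + 1)))
        ≤ (c k - c (k + 1)) * ((1 - 2 / a (k + 1)) * (1 - S)) :=
          mul_le_mul_of_nonneg_left (by nlinarith) hlen.le
      _ = (c k - c (k + 1)) * (1 - 2 / a (k + 1)) * (1 - S) := by ring
      _ ≤ ((a k - 1 : ℕ) : ℝ) * (c (k + 1) - c (k + 2)) * (1 - S) :=
          mul_le_mul_of_nonneg_right (h.length_succ_lower (htwo k le_rfl)) (by linarith)
      _ = _ := by rw [mul_assoc]

theorem exists_volume_uniqueCore_pos (h : IsEuclideanScale a c)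
    (hsum : Summable fun n => 1 / (a n : ℝ)) : ∃ k, 0 < volume (uniqueCore a c k) := by
  have hnonneg : ∀ n, 0 ≤ 2 / (a n : ℝ) := fun n => by positivity
  have hsum2 : Summable fun n => 2 / (a n : ℝ) := by
    simpa only [mul_one_div] using hsum.mul_left 2
  -- A tail below `1 / 2` both forces `a j ≥ 2` from `k` on and keeps at least half of the interval.
  obtain ⟨k, hk⟩ := ((tendsto_order.1 (tendsto_sum_nat_add fun n => 2 / (a n : ℝ))).2 (1 / 2)
    (by norm_num)).exists
  have hsumk : Summable fun n => 2 / (a (n + k) : ℝ) := (summable_nat_add_iff k).2 hsum2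
  have htwo : ∀ j, k ≤ j → 2 ≤ a j := by
    intro j hj
    have hle : 2 / (a j : ℝ) ≤ 1 / 2 := by
      have := hsumk.le_tsum (j - k) fun i _ => hnonneg _
      rw [Nat.sub_add_cancel hj] at this
      linarith
    have hpos : (0 : ℝ) < a j := by exact_mod_cast h.one_le j
    rw [div_le_div_iff₀ hpos two_pos] at hle
    have : (2 : ℝ) ≤ a j := by linarith
    exact_mod_cast this
  have hpartial : ∀ n, ∑ j ∈ Finset.range n, 2 / (a (k + 1 + j) : ℝ) ≤ 1 / 2 := by
    intro n
    -- One extra term: this tail starts at `a k`, the required sum at `a (k + 1)`.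
    have hle := hsumk.sum_le_tsum (Finset.range (n + 1)) fun i _ => hnonneg _
    rw [Finset.sum_range_succ'] at hle
    have hidx : ∀ j, j + 1 + k = k + 1 + j := fun j => by omega
    simp only [hidx] at hle
    linarith [hnonneg (0 + k)]
  have hlen : 0 < c k - c (k + 1) := sub_pos.2 (h.succ_lt k)
  refine ⟨k, lt_of_lt_of_le (b := ENNReal.ofReal ((c k - c (k + 1)) * (1 / 2)))
    (ENNReal.ofReal_pos.2 (by positivity)) ?_⟩
  refine le_trans ?_ (measure_mono (h.iInter_forcedCore_subset k))
  have hlim := tendsto_measure_iInter_atTop (μ := volume) (s := fun n => forcedCore a c n k)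
    (fun n => (measurableSet_forcedCore a c n k).nullMeasurableSet)
    (antitone_nat_of_succ_le fun n => h.forcedCore_succ_subset n k)
    ⟨0, by simp [forcedCore]⟩
  refine ge_of_tendsto' hlim fun n => le_trans (ENNReal.ofReal_le_ofReal ?_)
    (h.le_volume_forcedCore n k htwo ((hpartial n).trans (by norm_num)))
  exact mul_le_mul_of_nonneg_left (by linarith [hpartial n]) hlen.le

/-- Every point of `(0, c 0)` with a unique expansion lies in the scale or in a `uniqueCore`. -/
theorem subset_range_union_iUnion_uniqueCore (h : IsEuclideanScale a c) :
    {t | t ∈ Set.Ioo 0 (c 0) ∧ ∃! x, IsTailExpansion a c 0 t x} ⊆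
      Set.range c ∪ ⋃ k, uniqueCore a c k := by
  rintro t ⟨⟨h0, h1⟩, ht⟩
  have hex : ∃ n, c n ≤ t := ((tendsto_order.1 h.tendsto_zero).2 t h0).exists.imp fun _ => le_of_lt
  classical
  obtain ⟨k, hk⟩ : ∃ k, Nat.find hex = k + 1 := by
    refine Nat.exists_eq_succ_of_ne_zero fun hz => ?_
    have := Nat.find_spec hex
    rw [hz] at this
    linarith
  have hlo : c (k + 1) ≤ t := hk ▸ Nat.find_spec hex
  have hhi : t < c k := not_le.1 (Nat.find_min hex (m := k) (by omega))
  rcases hlo.eq_or_lt with heq | hlt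
  · exact Or.inl ⟨_, heq⟩
  · exact Or.inr (Set.mem_iUnion.2
      ⟨k, ⟨hlt, hhi⟩, (h.existsUnique_isTailExpansion_iff_of_lt hhi).2 ht⟩)

theorem uniqueCore_subset_existsUnique (h : IsEuclideanScale a c) (k : ℕ) :
    uniqueCore a c k ⊆ {t | t ∈ Set.Ioo 0 (c 0) ∧ ∃! x, IsTailExpansion a c 0 t x} :=
  fun _ ht => ⟨⟨(h.pos _).trans ht.1.1, ht.1.2.trans_le (h.strictAnti.antitone (Nat.zero_le k))⟩,
    (h.existsUnique_isTailExpansion_iff_of_lt ht.1.2).1 ht.2⟩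

theorem volume_existsUnique_eq_zero_iff (h : IsEuclideanScale a c) :
    volume {t | t ∈ Set.Ioo 0 (c 0) ∧ ∃! x, IsTailExpansion a c 0 t x} = 0 ↔
      Tendsto (fun N : ℕ => ∑ n ∈ Finset.range N, 1 / (a n : ℝ)) atTop atTop := by
  constructor
  · intro hzero
    rw [← not_summable_iff_tendsto_nat_atTop_of_nonneg fun n => by positivity]
    intro hsum
    obtain ⟨k, hk⟩ := h.exists_volume_uniqueCore_pos hsum
    exact hk.ne' (measure_mono_null (h.uniqueCore_subset_existsUnique k) hzero)
  · intro hdiv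
    refine measure_mono_null h.subset_range_union_iUnion_uniqueCore (measure_union_null ?_ ?_)
    · exact (Set.countable_range c).measure_zero _
    · exact measure_iUnion_null (h.volume_uniqueCore_eq_zero hdiv)

end IsEuclideanScale

theorem uniqueExpansionSet_eq (α : ℝ) :
    uniqueExpansionSet α = {t | t ∈ Set.Ioo 0 (rotScale α 0) ∧
      ∃! x, IsTailExpansion (partialQuotient α) (rotScale α) 0 t x} := by
  ext t
  simp [uniqueExpansionSet, IsTailExpansion, digitSpace, rotScale]

theorem mainTheorem2 (α : ℝ) (hirr : Irrational α) (hα : α ∈ Set.Ioo (0 : ℝ) 1) :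
    volume (uniqueExpansionSet α) = 0 ↔
      Tendsto (fun N : ℕ => ∑ n ∈ Finset.range N, 1 / (partialQuotient α n : ℝ)) atTop atTop := by
  rw [uniqueExpansionSet_eq]
  exact (isEuclideanScale_rotScale hirr hα).volume_existsUnique_eq_zero_iff
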